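/- All graphs are finite and simple. For a graph $G$ write $d_G(v)$ for the degree of $v$ and $N_G(v)$ for its neighborhood. An *$o$-heavy pair* of $G$ is a pair of distinct nonadjacent vertices $u,v$ with $d_G(u)+d_G(v)\ge |V(G)|$; an *$a$-heavy pair* is a pair of adjacent vertices $u,v$ with $d_G(u)+d_G(v)\ge|V(G)|$. For a graph $F$, $G$ is *$F$-$o$-heavy* if every induced subgraph of $G$ isomorphic to $F$ contains an $o$-heavy pair of $G$. Let $K_{1,3}$ be the claw and let $N$ be the net (a triangle with one pendant edge attached at each of its three vertices). $G$ is *$\{K_{1,3},N\}$-$o$-heavy* if it is both $K_{1,3}$-$o$-heavy and $N$-$o$-heavy; it is *claw-free* if it has no induced subgraph isomorphic to $K_{1,3}$, and *$N$-$p$-heavy* if the triangle of every induced net of $G$ contains an $a$-heavy pair of $G$. For a vertex $x$ of $G$ let $G_x^{BC}$ be the graph on $V(G)$ obtained from $G$ by adding all edges $uv$ with $u,v\in N_G(x)$ such that $\{u,v\}$ is an $o$-heavy pair of $G$. The vertex $x$ is *$c$-eligible* in $G$ if $N_G(x)$ is not a clique of $G$ and either (i) $G_x^{BC}[N_G(x)]$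 is connected, or (ii) $G_x^{BC}[N_G(x)]$ is the disjoint union of two cliques $C_1$ and $C_2$, and there is an $o$-heavy pair $\{x,z\}$ of $G$ such that $zy_1,zy_2\in E(G)$ for some $y_1\in C_1$ and $y_2\in C_2$. The *local $c$-completion* of $G$ at a $c$-eligible vertex $x$ is the graph obtained from $G$ by adding all missing edges between vertices of $N_G(x)$. The *$c$-closure* $\mathrm{cl}_c(G)$ of a $K_{1,3}$-$o$-heavy graph $G$ is the graph obtained from $G$ by successively performing local $c$-completions at $c$-eligible vertices (of the current graph), until no $c$-eligible vertex is left. **Theorem.** Let $G$ be a $\{K_{1,3},N\}$-$o$-heavy graph. Then $\mathrm{cl}_c(G)$ is claw-free and $N$-$p$-heavy. (The claim holds for every graph that can result from the procedure. $G$ is not assumed to be 2-connected, or even connected.) -/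

import Mathlib

namespace HeavyClosure

/-- Two nonadjacent (distinct) vertices whose degree sum is at least the order of the graph. -/
def IsOHeavyPair {V : Type*} [Fintype V] (G : SimpleGraph V) (u v : V) : Prop :=
  open Classical in u ≠ v ∧ ¬ G.Adj u v ∧ Fintype.card V ≤ G.degree u + G.degree v

/-- Two adjacent vertices whose degree sum is at least the order of the graph. -/
def IsAHeavyPair {V : Type*} [Fintype V] (G : SimpleGraph V) (u v : V) : Prop :=
  open Classical in G.Adj u v ∧ Fintype.card V ≤ G.degree u + G.degree v

/-- `G` is `H`-`o`-heavy: every induced subgraph of `G` isomorphic to `H` contains two vertices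
that form an `o`-heavy pair of `G`. -/
def IsOHeavy {W V : Type*} [Fintype V] (H : SimpleGraph W) (G : SimpleGraph V) : Prop :=
  ∀ f : H ↪g G, ∃ i j : W, IsOHeavyPair G (f i) (f j)

/-- `G` is `H`-free: no induced subgraph of `G` is isomorphic to `H`. -/
def IsFree {W V : Type*} (H : SimpleGraph W) (G : SimpleGraph V) : Prop :=
  ¬ H.IsIndContained G

/-- The claw `K_{1,3}`. -/
def claw : SimpleGraph (Fin 1 ⊕ Fin 3) := completeBipartiteGraph (Fin 1) (Fin 3)

/-- The net: a triangle `a₁a₂a₃` (with `aᵢ = inl i`) and a pendant edge `aᵢbᵢ` (with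
`bᵢ = inr i`) at each of its vertices. -/
def net : SimpleGraph (Fin 3 ⊕ Fin 3) where
  Adj
    | .inl i, .inl j => i ≠ j
    | .inl i, .inr j => i = j
    | .inr i, .inl j => i = j
    | .inr _, .inr _ => False
  symm := ⟨by
    rintro (i | i) (j | j) h
    · exact Ne.symm h
    · exact Eq.symm h
    · exact Eq.symm h
    · exact h⟩
  loopless := ⟨by
    rintro (i | i) h
    · exact h rfl
    · exact h⟩

/-- `G` is `N`-`p`-heavy: the triangle of every induced net of `G` contains an `a`-heavy pair
of `G`. -/
def IsNetPHeavy {V : Type*} [Fintype V] (G : SimpleGraph V) : Prop :=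
  ∀ f : net ↪g G, ∃ i j : Fin 3, IsAHeavyPair G (f (Sum.inl i)) (f (Sum.inl j))

/-- The graph `G_x^{BC}`: the graph `G` together with all edges joining `o`-heavy pairs of `G`
inside the neighborhood of `x`. -/
def bcGraph {V : Type*} [Fintype V] (G : SimpleGraph V) (x : V) : SimpleGraph V where
  Adj u v := G.Adj u v ∨ (G.Adj x u ∧ G.Adj x v ∧ IsOHeavyPair G u v)
  symm := ⟨by
    rintro u v (h | ⟨hu, hv, hne, hn, hd⟩)
    · exact Or.inl h.symm
    · exact Or.inr ⟨hv, hu, hne.symm, fun h => hn h.symm, by rwa [add_comm]⟩⟩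
  loopless := ⟨by
    rintro u (h | ⟨_, _, h, _⟩)
    · exact G.irrefl h
    · exact h rfl⟩

/-- `x` is a `c`-eligible vertex of `G`. -/
def IsCEligible {V : Type*} [Fintype V] (G : SimpleGraph V) (x : V) : Prop :=
  ¬ G.IsClique (G.neighborSet x) ∧
    (((bcGraph G x).induce (G.neighborSet x)).Connected ∨
      ∃ C₁ C₂ : Set V, C₁ ∪ C₂ = G.neighborSet x ∧ Disjoint C₁ C₂ ∧
        (bcGraph G x).IsClique C₁ ∧ (bcGraph G x).IsClique C₂ ∧
        (∀ u ∈ C₁, ∀ v ∈ C₂, ¬ (bcGraph G x).Adj u v) ∧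
        ∃ z : V, IsOHeavyPair G x z ∧ ∃ y₁ ∈ C₁, ∃ y₂ ∈ C₂, G.Adj z y₁ ∧ G.Adj z y₂)

/-- The local completion of `G` at `x`: the neighborhood of `x` is turned into a clique. -/
def localCompletion {V : Type*} (G : SimpleGraph V) (x : V) : SimpleGraph V where
  Adj u v := G.Adj u v ∨ (u ≠ v ∧ G.Adj x u ∧ G.Adj x v)
  symm := ⟨by
    rintro u v (h | ⟨hne, hu, hv⟩)
    · exact Or.inl h.symm
    · exact Or.inr ⟨hne.symm, hv, hu⟩⟩
  loopless := ⟨by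
    rintro u (h | ⟨h, _⟩)
    · exact G.irrefl h
    · exact h rfl⟩

/-- `H` is obtained from `G` by one local `c`-completion, at a `c`-eligible vertex of `G`. -/
def CStep {V : Type*} [Fintype V] (G H : SimpleGraph V) : Prop :=
  ∃ x : V, IsCEligible G x ∧ H = localCompletion G x

/-- `H` is the `c`-closure of `G`: it results from `G` by finitely many (possibly zero) successive
local `c`-completions at `c`-eligible vertices of the current graph, and has no `c`-eligible
vertex itself. -/
def IsCClosure {V : Type*} [Fintype V] (G H : SimpleGraph V) : Prop :=
  Relation.ReflTransGen CStep G H ∧ ∀ x : V, ¬ IsCEligible H x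

/-- The recursive completion procedure always terminates, so every graph has a `c`-closure. -/
theorem exists_isCClosure {V : Type*} [Fintype V] (G : SimpleGraph V) :
    ∃ H, IsCClosure G H := by
  induction G using WellFoundedGT.induction with
  | ind G ih =>
    by_cases h : ∃ x, IsCEligible G x
    · obtain ⟨x, hx⟩ := h
      have hle : G ≤ localCompletion G x := fun u v huv => Or.inl huv
      have hlt : G < localCompletion G x := by
        refine lt_of_le_of_ne hle fun heq => hx.1 ?_
        intro u hu v hv hne
        rw [heq]
        exact Or.inr ⟨hne, hu, hv⟩
      obtain ⟨H, h₁, h₂⟩ := ih _ hlt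
      exact ⟨H, Relation.ReflTransGen.head ⟨x, hx, rfl⟩ h₁, h₂⟩
    · exact ⟨G, Relation.ReflTransGen.refl, fun x hx => h ⟨x, hx⟩⟩

end HeavyClosure

namespace HeavyClosure

/-! Local completion at any vertex keeps a graph claw-`o`-heavy, so the closure $H$ is
claw-`o`-heavy and has no eligible vertex. Around a non-eligible vertex the neighborhood is a clique
or splits into two parts, and a count of private neighbors then shows that $H$ has no `o`-heavy pair
whatsoever. Hence $H$ is claw-free. It is also diamond-free, so its edges fall into lines: cliques
that contain every common neighbor of two of their vertices.

Only three facts tie $G$ to $H$: $G\le H$, `o`-heavy pairs of $G$ are edges of $H$, and $G$ is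
connected on each line of $H$ (an edge added at $x$ is replaced by a path through $x$, which lies in
the same line).

Now suppose an induced net of $H$ has no `a`-heavy pair in its triangle $a_1a_2a_3$, and let $K$ be
the line through the triangle. Let $L$ consist of the $a_i$ and of the vertices of $K$ without
neighbors outside $K$; the latter have degree at most that of each $a_i$, so $L$ contains no
`o`-heavy pair of $G$. Still $G[L]$ is connected, because the other vertices of $K$ can be bypassed.
Attaching to each $a_i$ a suitable $G$-neighbor $c_i$ outside $K$ gives a connected induced subgraph
of $G$ with three leaves at distinct vertices and no `o`-heavy pair. Such a graph contains an
induced claw or net, a contradiction. -/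

/-! ### Degrees, claws and nets -/

open Classical in
theorem degree_le_degree {V : Type*} [Fintype V] {G H : SimpleGraph V} (h : G ≤ H) (v : V) :
    G.degree v ≤ H.degree v := by
  rw [← SimpleGraph.card_neighborFinset_eq_degree, ← SimpleGraph.card_neighborFinset_eq_degree]
  refine Finset.card_le_card fun w hw => ?_
  rw [SimpleGraph.mem_neighborFinset] at hw ⊢
  exact h hw

theorem IsOHeavyPair.symm {V : Type*} [Fintype V] {G : SimpleGraph V} {u v : V}
    (h : IsOHeavyPair G u v) : IsOHeavyPair G v u :=
  ⟨h.1.symm, fun e => h.2.1 e.symm, by rw [add_comm]; exact h.2.2⟩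

theorem IsOHeavyPair.mono {V : Type*} [Fintype V] {G H : SimpleGraph V} (hle : G ≤ H) {u v : V}
    (h : IsOHeavyPair G u v) (hn : ¬ H.Adj u v) : IsOHeavyPair H u v :=
  ⟨h.1, hn, h.2.2.trans (add_le_add (degree_le_degree hle u) (degree_le_degree hle v))⟩

theorem exists_claw_embedding {V : Type*} {G : SimpleGraph V} {x p q r : V} (hp : G.Adj x p)
    (hq : G.Adj x q) (hr : G.Adj x r) (pq : p ≠ q) (pr : p ≠ r) (qr : q ≠ r)
    (npq : ¬ G.Adj p q) (npr : ¬ G.Adj p r) (nqr : ¬ G.Adj q r) :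
    ∃ f : claw ↪g G, f (.inl 0) = x ∧ f (.inr 0) = p ∧ f (.inr 1) = q ∧ f (.inr 2) = r := by
  have hx : ∀ i : Fin 3, G.Adj x (![p, q, r] i) := by
    intro i
    fin_cases i
    exacts [hp, hq, hr]
  have hne : ∀ i j : Fin 3, ![p, q, r] i = ![p, q, r] j → i = j := by
    intro i j h
    fin_cases i <;> fin_cases j <;> simp_all [eq_comm]
  have hn : ∀ i j : Fin 3, ¬ G.Adj (![p, q, r] i) (![p, q, r] j) := by
    intro i j h
    have h' := h.symm
    fin_cases i <;> fin_cases j <;> simp_all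
  refine ⟨⟨⟨Sum.elim (fun _ => x) ![p, q, r], ?_⟩, ?_⟩, rfl, rfl, rfl, rfl⟩
  · rintro (i | i) (j | j) h
    · rw [Subsingleton.elim i j]
    · exact absurd h (hx j).ne
    · exact absurd h (hx i).ne'
    · rw [hne i j h]
  · rintro (i | i) (j | j)
    · exact iff_of_false G.irrefl (by simp [claw])
    · exact iff_of_true (hx j) (by simp [claw])
    · exact iff_of_true (hx i).symm (by simp [claw])
    · exact iff_of_false (hn i j) (by simp [claw])

theorem exists_net_embedding {V : Type*} {G : SimpleGraph V} {a b : Fin 3 → V}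
    (haa : ∀ i j, i ≠ j → G.Adj (a i) (a j)) (hab : ∀ i j, G.Adj (a i) (b j) ↔ i = j)
    (hbb : ∀ i j, ¬ G.Adj (b i) (b j)) (hne : ∀ i j, a i ≠ b j) :
    Nonempty (net ↪g G) := by
  refine ⟨⟨⟨Sum.elim a b, ?_⟩, ?_⟩⟩
  · rintro (i | i) (j | j) h
    · by_contra hij
      exact (haa i j fun e => hij (congrArg _ e)).ne h
    · exact absurd h (hne i j)
    · exact absurd h.symm (hne j i)
    · have := (hab i i).2 rfl
      simp only [Sum.elim_inr] at h
      rw [h, hab] at this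
      rw [this]
  · rintro (i | i) (j | j)
    · exact ⟨fun h e => h.ne (congrArg a e), haa i j⟩
    · exact hab i j
    · exact ⟨fun h => ((hab j i).1 h.symm).symm, fun h => ((hab j i).2 (Eq.symm h)).symm⟩
    · exact ⟨fun h => hbb i j h, False.elim⟩

/-- A claw in a claw-`o`-heavy graph has two end vertices that form an `o`-heavy pair. -/
theorem IsOHeavy.exists_pair_of_claw {V : Type*} [Fintype V] {G : SimpleGraph V}
    (hG : IsOHeavy claw G) {x p q r : V} (hp : G.Adj x p) (hq : G.Adj x q) (hr : G.Adj x r)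
    (pq : p ≠ q) (pr : p ≠ r) (qr : q ≠ r)
    (npq : ¬ G.Adj p q) (npr : ¬ G.Adj p r) (nqr : ¬ G.Adj q r) :
    IsOHeavyPair G p q ∨ IsOHeavyPair G p r ∨ IsOHeavyPair G q r := by
  obtain ⟨f, fx, fp, fq, fr⟩ := exists_claw_embedding hp hq hr pq pr qr npq npr nqr
  obtain ⟨i, j, h⟩ := hG f
  have key : ∀ u v, IsOHeavyPair G u v → ¬ G.Adj u v ∧ ¬ G.Adj v u ∧ u ≠ v ∧
      IsOHeavyPair G v u := fun u v h => ⟨h.2.1, h.symm.2.1, h.1, h.symm⟩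
  have := key _ _ h
  rcases i with i | i <;> rcases j with j | j <;> fin_cases i <;> fin_cases j <;>
    simp_all

/-! ### Claw-heaviness along the completion procedure -/

/-- Local completion preserves the property of being claw-`o`-heavy. -/
theorem IsOHeavy.localCompletion {V : Type*} [Fintype V] {G : SimpleGraph V}
    (hG : IsOHeavy claw G) (x : V) : IsOHeavy claw (localCompletion G x) := by
  have hle : G ≤ HeavyClosure.localCompletion G x := fun u v h => Or.inl h
  have main : ∀ y u v w : V, (HeavyClosure.localCompletion G x).Adj y u →
      (HeavyClosure.localCompletion G x).Adj y v → (HeavyClosure.localCompletion G x).Adj y w →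
      u ≠ v → u ≠ w → v ≠ w → ¬ (HeavyClosure.localCompletion G x).Adj u v →
      ¬ (HeavyClosure.localCompletion G x).Adj u w →
      ¬ (HeavyClosure.localCompletion G x).Adj v w → ¬ G.Adj y u →
      IsOHeavyPair (HeavyClosure.localCompletion G x) u v ∨
      IsOHeavyPair (HeavyClosure.localCompletion G x) u w ∨
      IsOHeavyPair (HeavyClosure.localCompletion G x) v w := by
    intro y u v w yu yv yw uv uw vw nuv nuw nvw hn
    obtain ⟨-, xy, xu⟩ := yu.resolve_left hn
    have nxv : ¬ G.Adj x v := fun h => nuv (Or.inr ⟨uv, xu, h⟩)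
    have nxw : ¬ G.Adj x w := fun h => nuw (Or.inr ⟨uw, xu, h⟩)
    have gyv : G.Adj y v := yv.resolve_right fun h => nxv h.2.2
    have gyw : G.Adj y w := yw.resolve_right fun h => nxw h.2.2
    have xv : x ≠ v := fun h => nuv (h ▸ Or.inl xu.symm)
    have xw : x ≠ w := fun h => nuw (h ▸ Or.inl xu.symm)
    -- The new closed neighborhood of `u` contains the old one of `x`.
    have deg : open Classical in
        G.degree x ≤ (HeavyClosure.localCompletion G x).degree u := by
      classical
      rw [← SimpleGraph.card_neighborFinset_eq_degree,
        ← SimpleGraph.card_neighborFinset_eq_degree,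
        ← Finset.card_erase_add_one (by simpa using xu : u ∈ G.neighborFinset x),
        ← Finset.card_insert_of_notMem (a := x) (by simp)]
      refine Finset.card_le_card fun t ht => ?_
      simp only [Finset.mem_insert, Finset.mem_erase, SimpleGraph.mem_neighborFinset] at ht ⊢
      rcases ht with rfl | ⟨h1, h2⟩
      · exact Or.inl xu.symm
      · exact Or.inr ⟨h1.symm, xu, h2⟩
    -- Since `yu` is a new edge, `x` replaces `u` as an end of the claw in `G`.
    rcases hG.exists_pair_of_claw xy.symm gyv gyw xv xw vw nxv nxw fun h => nvw (Or.inl h)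
      with h | h | h
    · exact Or.inl ⟨uv, nuv, h.2.2.trans (add_le_add deg (degree_le_degree hle v))⟩
    · exact Or.inr (Or.inl ⟨uw, nuw, h.2.2.trans (add_le_add deg (degree_le_degree hle w))⟩)
    · exact Or.inr (Or.inr (h.mono hle nvw))
  intro f
  have adj : ∀ i, (HeavyClosure.localCompletion G x).Adj (f (.inl 0)) (f (.inr i)) :=
    fun i => f.map_adj_iff.2 (by simp [claw])
  have nadj : ∀ i j, ¬ (HeavyClosure.localCompletion G x).Adj (f (.inr i)) (f (.inr j)) :=
    fun i j h => by simpa [claw] using f.map_adj_iff.1 h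
  have ne : ∀ i j : Fin 3, i ≠ j → f (.inr i) ≠ f (.inr j) := fun i j h e => by
    simpa [h] using f.injective e
  have step : ∀ i j k : Fin 3, i ≠ j → i ≠ k → j ≠ k → ¬ G.Adj (f (.inl 0)) (f (.inr i)) →
      ∃ i j, IsOHeavyPair (HeavyClosure.localCompletion G x) (f i) (f j) := by
    intro i j k ij ik jk hn
    rcases main _ _ _ _ (adj i) (adj j) (adj k) (ne i j ij) (ne i k ik) (ne j k jk) (nadj i j)
      (nadj i k) (nadj j k) hn with h | h | h <;> exact ⟨_, _, h⟩
  by_cases h0 : G.Adj (f (.inl 0)) (f (.inr 0))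
  · by_cases h1 : G.Adj (f (.inl 0)) (f (.inr 1))
    · by_cases h2 : G.Adj (f (.inl 0)) (f (.inr 2))
      · rcases hG.exists_pair_of_claw h0 h1 h2 (ne 0 1 (by decide)) (ne 0 2 (by decide))
          (ne 1 2 (by decide)) (fun h => nadj _ _ (hle h)) (fun h => nadj _ _ (hle h))
          (fun h => nadj _ _ (hle h)) with h | h | h <;>
        exact ⟨_, _, h.mono hle (nadj _ _)⟩
      · exact step 2 0 1 (by decide) (by decide) (by decide) h2
    · exact step 1 0 2 (by decide) (by decide) (by decide) h1
  · exact step 0 1 2 (by decide) (by decide) (by decide) h0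

theorem IsOHeavy.of_reflTransGen_cStep {V : Type*} [Fintype V] {G H : SimpleGraph V}
    (hG : IsOHeavy claw G) (h : Relation.ReflTransGen CStep G H) : IsOHeavy claw H := by
  induction h with
  | refl => exact hG
  | tail _ h ih =>
    obtain ⟨x, -, rfl⟩ := h
    exact ih.localCompletion x

theorem le_of_reflTransGen_cStep {V : Type*} [Fintype V] {G H : SimpleGraph V}
    (h : Relation.ReflTransGen CStep G H) : G ≤ H := by
  induction h with
  | refl => exact le_rfl
  | tail _ h ih =>
    obtain ⟨x, -, rfl⟩ := h
    exact ih.trans fun u v h => Or.inl h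

/-! ### Graphs without eligible vertices -/

/-- In a claw-`o`-heavy graph, the neighborhood of a vertex that is not `c`-eligible is a clique
or splits into two parts as in the second eligibility condition, but without the vertex `z`. -/
theorem exists_split_of_not_isCEligible {V : Type*} [Fintype V] {H : SimpleGraph V}
    (hH : IsOHeavy claw H) {x : V} (hx : ¬ IsCEligible H x)
    (hc : ¬ H.IsClique (H.neighborSet x)) :
    ∃ C₁ C₂ : Set V, C₁ ∪ C₂ = H.neighborSet x ∧ C₁.Nonempty ∧ C₂.Nonempty ∧
      (bcGraph H x).IsClique C₁ ∧ (bcGraph H x).IsClique C₂ ∧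
      (∀ u ∈ C₁, ∀ v ∈ C₂, ¬ (bcGraph H x).Adj u v) ∧
      ∀ z, IsOHeavyPair H x z → ∀ y₁ ∈ C₁, ∀ y₂ ∈ C₂, H.Adj z y₁ → ¬ H.Adj z y₂ := by
  have hncon : ¬ ((bcGraph H x).induce (H.neighborSet x)).Connected := fun h => hx ⟨hc, Or.inl h⟩
  have hne : Nonempty (H.neighborSet x) := by
    by_contra h
    rw [nonempty_subtype] at h
    exact hc fun u hu => (h ⟨u, hu⟩).elim
  have hnpre : ¬ ((bcGraph H x).induce (H.neighborSet x)).Preconnected :=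
    fun h => hncon ⟨h⟩
  simp only [SimpleGraph.Preconnected, not_forall] at hnpre
  obtain ⟨p, q, hpq⟩ := hnpre
  set B := (bcGraph H x).induce (H.neighborSet x) with hB
  -- Three independent vertices of `B` would be the ends of a claw without `o`-heavy pair. So the
  -- component of `p` and its complement are cliques: `q`, respectively `p`, serves as the third
  -- vertex.
  have tri : ∀ u v w : H.neighborSet x, u ≠ v → u ≠ w → v ≠ w →
      B.Adj u v ∨ B.Adj u w ∨ B.Adj v w := by
    intro u v w uv uw vw
    by_contra! hn
    have e : ∀ s t : H.neighborSet x, ¬ B.Adj s t → ¬ H.Adj s t ∧ ¬ IsOHeavyPair H s t :=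
      fun s t h => ⟨fun h' => h (Or.inl h'), fun h' => h (Or.inr ⟨s.2, t.2, h'⟩)⟩
    have h1 := e _ _ hn.1
    have h2 := e _ _ hn.2.1
    have h3 := e _ _ hn.2.2
    rcases hH.exists_pair_of_claw u.2 v.2 w.2 (Subtype.coe_ne_coe.2 uv) (Subtype.coe_ne_coe.2 uw)
      (Subtype.coe_ne_coe.2 vw) h1.1 h2.1 h3.1 with h | h | h
    exacts [h1.2 h, h2.2 h, h3.2 h]
  have cross : ∀ u v : H.neighborSet x, B.Reachable p u → ¬ B.Reachable p v →
      u ≠ v ∧ ¬ B.Adj u v :=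
    fun u v hu hv => ⟨fun e => hv (e ▸ hu), fun e => hv (hu.trans e.reachable)⟩
  have hU : Subtype.val '' {u | B.Reachable p u} ∪ Subtype.val '' {u | ¬ B.Reachable p u} =
      H.neighborSet x := by
    refine Set.ext fun u => ⟨?_, fun hu => ?_⟩
    · rintro (⟨v, -, rfl⟩ | ⟨v, -, rfl⟩) <;> exact v.2
    · by_cases h : B.Reachable p ⟨u, hu⟩
      · exact Or.inl ⟨_, h, rfl⟩
      · exact Or.inr ⟨_, h, rfl⟩
  have h1 : (bcGraph H x).IsClique (Subtype.val '' {u | B.Reachable p u}) := by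
    rintro _ ⟨u, hu, rfl⟩ _ ⟨v, hv, rfl⟩ huv
    rcases tri u v q (fun e => huv (congrArg _ e)) (cross u q hu hpq).1 (cross v q hv hpq).1
      with h | h | h
    exacts [h, ((cross u q hu hpq).2 h).elim, ((cross v q hv hpq).2 h).elim]
  have h2 : (bcGraph H x).IsClique (Subtype.val '' {u | ¬ B.Reachable p u}) := by
    rintro _ ⟨u, hu, rfl⟩ _ ⟨v, hv, rfl⟩ huv
    rcases tri p u v (cross p u (.refl _) hu).1 (cross p v (.refl _) hv).1
      (fun e => huv (congrArg _ e)) with h | h | h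
    exacts [((cross p u (.refl _) hu).2 h).elim, ((cross p v (.refl _) hv).2 h).elim, h]
  have h12 : ∀ u ∈ Subtype.val '' {u | B.Reachable p u},
      ∀ v ∈ Subtype.val '' {u | ¬ B.Reachable p u}, ¬ (bcGraph H x).Adj u v := by
    rintro _ ⟨u, hu, rfl⟩ _ ⟨v, hv, rfl⟩ h
    exact (cross u v hu hv).2 h
  refine ⟨_, _, hU, ⟨p, p, .refl _, rfl⟩, ⟨q, q, hpq, rfl⟩, h1, h2, h12, ?_⟩
  intro z hz y₁ hy₁ y₂ hy₂ e₁ e₂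
  refine hx ⟨hc, Or.inr ⟨_, _, hU, ?_, h1, h2, h12, z, hz, y₁, hy₁, y₂, hy₂, e₁, e₂⟩⟩
  rw [Set.disjoint_image_iff Subtype.val_injective, Set.disjoint_left]
  exact fun u h h' => h' h

/-- The same splitting, with the parts named after a given neighbor. -/
theorem exists_split_of_mem {V : Type*} [Fintype V] {H : SimpleGraph V}
    (hH : IsOHeavy claw H) {x a : V} (hx : ¬ IsCEligible H x)
    (hc : ¬ H.IsClique (H.neighborSet x)) (ha : H.Adj x a) :
    ∃ C₁ C₂ : Set V, C₁ ∪ C₂ = H.neighborSet x ∧ a ∈ C₁ ∧ C₂.Nonempty ∧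
      (bcGraph H x).IsClique C₁ ∧
      (∀ u ∈ C₁, ∀ v ∈ C₂, ¬ (bcGraph H x).Adj u v) ∧
      ∀ z, IsOHeavyPair H x z → ∀ y₁ ∈ C₁, ∀ y₂ ∈ C₂, H.Adj z y₁ → ¬ H.Adj z y₂ := by
  obtain ⟨C₁, C₂, hU, hn1, hn2, h1, h2, h12, hz⟩ := exists_split_of_not_isCEligible hH hx hc
  have : a ∈ C₁ ∪ C₂ := by rw [hU]; exact ha
  rcases this with h | h
  · exact ⟨C₁, C₂, hU, h, hn2, h1, h12, hz⟩
  · exact ⟨C₂, C₁, by rw [Set.union_comm, hU], h, hn1, h2, fun u hu v hv e => h12 v hv u hu e.symm,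
      fun z hz' y₁ hy₁ y₂ hy₂ e₁ e₂ => hz z hz' y₂ hy₂ y₁ hy₁ e₂ e₁⟩

/-- A claw-`o`-heavy graph without `c`-eligible vertices has no `o`-heavy pair at all. -/
theorem not_isOHeavyPair_of_no_eligible {V : Type*} [Fintype V] {H : SimpleGraph V}
    (hH : IsOHeavy claw H) (hx : ∀ x, ¬ IsCEligible H x) (a b : V) : ¬ IsOHeavyPair H a b := by
  classical
  intro hab
  -- Both `a` and `b` lie in one part of the neighborhood of `k`; the private vertex `c` is taken
  -- from the other part.
  have key : ∀ k, H.Adj k a → H.Adj k b → ∃ c, H.Adj k c ∧ c ≠ a ∧ c ≠ b ∧ ¬ H.Adj a c ∧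
      ¬ H.Adj b c ∧ (∀ k', H.Adj k k' → H.Adj k' a → ¬ H.Adj k' c) ∧
      (∀ k', IsOHeavyPair H k k' → H.Adj k' a → ¬ H.Adj k' c) := by
    intro k ka kb
    have hc : ¬ H.IsClique (H.neighborSet k) := fun h => hab.2.1 (h ka kb hab.1)
    obtain ⟨C₁, C₂, hU, ha, ⟨c, hc2⟩, h1, h12, hz⟩ := exists_split_of_mem hH (hx k) hc ka
    have mem : ∀ v, H.Adj k v → (bcGraph H k).Adj a v → v ∈ C₁ := fun v hv e => by
      have : v ∈ C₁ ∪ C₂ := by rw [hU]; exact hv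
      exact this.resolve_right fun h => h12 a ha v h e
    have hb : b ∈ C₁ := mem b kb (Or.inr ⟨ka, kb, hab⟩)
    have kc : c ∈ H.neighborSet k := hU ▸ Or.inr hc2
    refine ⟨c, kc, ?_, ?_, fun e => h12 a ha c hc2 (Or.inl e), fun e => h12 b hb c hc2 (Or.inl e),
      fun k' e1 e2 e3 => h12 k' (mem k' e1 (Or.inl e2.symm)) c hc2 (Or.inl e3),
      fun k' e1 e2 e3 => hz k' e1 a ha c hc2 e2 e3⟩
    · rintro rfl
      exact h12 b hb c hc2 (Or.inr ⟨kb, ka, hab.symm⟩)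
    · rintro rfl
      exact h12 a ha c hc2 (Or.inr ⟨ka, kb, hab⟩)
  choose! c hkc hca hcb hac hbc hadj hheavy using key
  set K := H.neighborFinset a ∩ H.neighborFinset b with hK
  have memK : ∀ k, k ∈ K ↔ H.Adj k a ∧ H.Adj k b := fun k => by
    simp [hK, H.adj_comm k]
  -- If nonadjacent `k`, `k'` shared their private vertex, they would either form an `o`-heavy pair,
  -- making `k` eligible, or lie in different parts around `a`, where `b` makes `a` eligible.
  have inj : Set.InjOn c K := by
    intro k hk k' hk' e
    obtain ⟨ka, kb⟩ := (memK k).1 hk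
    obtain ⟨ka', kb'⟩ := (memK k').1 hk'
    by_contra hne
    have hk'c : H.Adj k' (c k) := e ▸ hkc k' ka' kb'
    by_cases hkk : H.Adj k k'
    · exact hadj k ka kb k' hkk ka' hk'c
    · have hc : ¬ H.IsClique (H.neighborSet a) := fun h => hkk (h ka.symm ka'.symm hne)
      obtain ⟨C₁, C₂, hU, hm, -, h1, h12, hz⟩ := exists_split_of_mem hH (hx a) hc ka.symm
      have : k' ∈ C₁ ∪ C₂ := by rw [hU]; exact ka'.symm
      rcases this with h | h
      · exact hheavy k ka kb k' ((h1 hm h hne).resolve_left hkk).2.2 ka' hk'c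
      · exact hz b hab k hm k' h kb.symm kb'.symm
  have hsub : Disjoint (insert a (insert b (H.neighborFinset a ∪ H.neighborFinset b)))
      (K.image c) := by
    rw [Finset.disjoint_right]
    intro v hv
    obtain ⟨k, hk, rfl⟩ := Finset.mem_image.1 hv
    obtain ⟨ka, kb⟩ := (memK k).1 hk
    simp [hca k ka kb, hcb k ka kb, hac k ka kb, hbc k ka kb]
  -- The count yields $d(a)+d(b)+2\le|V|$.
  have hcard := Finset.card_le_univ
    (insert a (insert b (H.neighborFinset a ∪ H.neighborFinset b)) ∪ K.image c)
  rw [Finset.card_union_of_disjoint hsub, Finset.card_image_of_injOn inj,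
    Finset.card_insert_of_notMem (by simp [hab.1, hab.symm.2.1]),
    Finset.card_insert_of_notMem (by simp [hab.2.1])] at hcard
  have := Finset.card_union_add_card_inter (H.neighborFinset a) (H.neighborFinset b)
  have h3 := hab.2.2
  simp only [← SimpleGraph.card_neighborFinset_eq_degree] at h3
  rw [← hK] at this
  have : Fintype.card V ≤ (H.neighborFinset a).card + (H.neighborFinset b).card := by
    convert h3
  omega

/-- `H` has no induced diamond: adjacency is transitive within each neighborhood. -/
def DiamondFree {V : Type*} (H : SimpleGraph V) : Prop :=
  ∀ ⦃x p q r : V⦄, H.Adj x p → H.Adj x q → H.Adj x r → H.Adj p q → H.Adj q r → p ≠ r → H.Adj p r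

/-- The parts of a neighborhood are cliques of `bcGraph`, which adds nothing when there are no
`o`-heavy pairs. -/
theorem diamondFree_of_no_eligible {V : Type*} [Fintype V] {H : SimpleGraph V}
    (hH : IsOHeavy claw H) (hx : ∀ x, ¬ IsCEligible H x) : DiamondFree H := by
  intro x p q r xp xq xr pq qr hne
  by_cases hc : H.IsClique (H.neighborSet x)
  · exact hc xp xr hne
  obtain ⟨C₁, C₂, hU, hp, -, h1, h12, -⟩ := exists_split_of_mem hH (hx x) hc xp
  have hq : q ∈ C₁ ∪ C₂ := by rw [hU]; exact xq
  have hr : r ∈ C₁ ∪ C₂ := by rw [hU]; exact xr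
  have hq := hq.resolve_right fun h => h12 p hp q h (Or.inl pq)
  have hr := hr.resolve_right fun h => h12 q hq r h (Or.inl qr)
  exact (h1 hp hr hne).resolve_right fun h =>
    not_isOHeavyPair_of_no_eligible hH hx _ _ h.2.2

theorem isFree_claw_of_no_eligible {V : Type*} [Fintype V] {H : SimpleGraph V}
    (hH : IsOHeavy claw H) (hx : ∀ x, ¬ IsCEligible H x) : IsFree claw H := by
  rintro ⟨f⟩
  obtain ⟨i, j, h⟩ := hH f
  exact not_isOHeavyPair_of_no_eligible hH hx _ _ h

/-! ### Claws and nets in connected graphs with three leaves -/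

/-- A shortcut between two vertices of a shortest walk would shorten the walk; hence shortest walks
are induced paths. -/
theorem getVert_dist_le {W : Type*} {G : SimpleGraph W} (hG : G.Connected) {u v : W}
    (p : G.Walk u v) (hp : p.length = G.dist u v) {i j : ℕ} (hj : j ≤ p.length) :
    j ≤ i + G.dist (p.getVert i) (p.getVert j) := by
  have h1 := SimpleGraph.dist_le (p.take i)
  have h2 := SimpleGraph.dist_le (p.drop j)
  have h3 := hG.dist_triangle (u := u) (v := p.getVert i) (w := v)
  have h4 := hG.dist_triangle (u := p.getVert i) (v := p.getVert j) (w := v)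
  rw [SimpleGraph.Walk.take_length] at h1
  rw [SimpleGraph.Walk.drop_length] at h2
  omega

/-- A connected graph with three leaves at distinct vertices contains an induced claw or net. -/
theorem exists_claw_or_net {W : Type*} {G : SimpleGraph W} (hG : G.Connected) {a b : Fin 3 → W}
    (hb : ∀ i w, G.Adj (b i) w ↔ w = a i) (ha : Function.Injective a) (hab : ∀ i j, b i ≠ a j) :
    Nonempty (claw ↪g G) ∨ Nonempty (net ↪g G) := by
  have hbinj : ∀ i j, b i = b j → i = j := fun i j h =>
    ha (((hb j _).1 (h ▸ (hb i _).2 rfl)))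
  obtain ⟨p, hp⟩ := hG.exists_walk_length_eq_dist (b 0) (b 1)
  set n := p.length with hn
  set g := p.getVert with hg
  have g0 : g 0 = b 0 := p.getVert_zero
  have gn : g n = b 1 := p.getVert_length
  have gadj : ∀ i, i < n → G.Adj (g i) (g (i + 1)) := fun i hi => p.adj_getVert_succ hi
  have gdist : ∀ i j, j ≤ n → j ≤ i + G.dist (g i) (g j) :=
    fun i j hj => getVert_dist_le hG p hp hj
  have ginj : ∀ i j, i < j → j ≤ n → g i ≠ g j := fun i j hij hj e => by
    have := gdist i j hj
    rw [e, SimpleGraph.dist_self] at this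
    omega
  have gnadj : ∀ i j, i + 1 < j → j ≤ n → ¬ G.Adj (g i) (g j) := fun i j hij hj e => by
    have := gdist i j hj
    rw [SimpleGraph.dist_eq_one_iff_adj.2 e] at this
    omega
  have n0 : 0 < n := by
    rcases Nat.eq_zero_or_pos n with h | h
    · rw [h, g0] at gn
      exact absurd (hbinj _ _ gn) (by decide)
    · exact h
  have g1 : g 1 = a 0 := (hb 0 _).1 (g0 ▸ gadj 0 n0)
  have gn1 : g (n - 1) = a 1 := by
    refine (hb 1 _).1 ?_
    have := (gadj (n - 1) (by omega)).symm
    rwa [Nat.sub_add_cancel n0, gn] at this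
  have b2 : ∀ i ≤ n, g i ≠ b 2 := by
    intro i hi e
    have i0 : i ≠ 0 := by
      rintro rfl
      exact absurd (hbinj _ _ (g0.symm.trans e)) (by decide)
    have i1 : i ≠ n := by
      rintro rfl
      exact absurd (hbinj _ _ (gn.symm.trans e)) (by decide)
    have e1 := (hb 2 _).1 (e ▸ gadj i (by omega))
    have e2 := gadj (i - 1) (by omega)
    rw [Nat.sub_add_cancel (by omega), e] at e2
    exact ginj (i - 1) (i + 1) (by omega) (by omega) (((hb 2 _).1 e2.symm).trans e1.symm)
  have claw_of : ∀ i q, 0 < i → i < n → G.Adj (g i) q → ¬ G.Adj (g (i - 1)) q →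
      ¬ G.Adj (g (i + 1)) q → g (i - 1) ≠ q → g (i + 1) ≠ q → Nonempty (claw ↪g G) := by
    intro i q i0 i1 h h1 h2 h3 h4
    have e := gadj (i - 1) (by omega)
    rw [Nat.sub_add_cancel i0] at e
    obtain ⟨f, -⟩ := exists_claw_embedding e.symm (gadj i i1) h
      (ginj _ _ (by omega) (by omega)) h3 h4 (gnadj _ _ (by omega) (by omega)) h1 h2
    exact ⟨f⟩
  by_cases h2 : ∃ i ≤ n, g i = a 2
  · obtain ⟨i, hi, e⟩ := h2
    have i0 : 0 < i := by
      rcases Nat.eq_zero_or_pos i with rfl | h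
      · exact (hab 0 2 (g0.symm.trans e)).elim
      · exact h
    have i1 : i < n := by
      rcases hi.eq_or_lt with rfl | h
      · exact (hab 1 2 (gn.symm.trans e)).elim
      · exact h
    refine Or.inl (claw_of i (b 2) i0 i1 ((hb 2 _).2 e).symm (fun h => ?_) (fun h => ?_)
      (b2 _ (by omega)) (b2 _ (by omega)))
    · exact ginj (i - 1) i (by omega) hi (((hb 2 _).1 h.symm).trans e.symm)
    · exact ginj i (i + 1) (by omega) (by omega) (e.trans ((hb 2 _).1 h.symm).symm)
  -- A walk to `b 2` must leave the closed neighborhood of the shortest path, along an edge from `q`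
  -- to `q'`. Then `q` has a neighbor on the path and `q'` has none.
  let D : Set W := {w | ∃ i ≤ n, w = g i ∨ G.Adj w (g i)}
  have hD0 : b 0 ∈ D := ⟨0, by omega, Or.inl g0.symm⟩
  have hD2 : b 2 ∉ D := by
    rintro ⟨i, hi, h | h⟩
    · exact b2 i hi h.symm
    · exact h2 ⟨i, hi, (hb 2 _).1 h⟩
  obtain ⟨w⟩ := hG.preconnected (b 0) (b 2)
  obtain ⟨d, -, hq, hq'⟩ := w.exists_boundary_dart D hD0 hD2
  obtain ⟨⟨q, q'⟩, hqq⟩ := d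
  simp only at hq hq' hqq
  have nq' : ∀ i ≤ n, ¬ G.Adj (g i) q' := fun i hi h => hq' ⟨i, hi, Or.inr h.symm⟩
  have neq' : ∀ i ≤ n, g i ≠ q' := fun i hi h => hq' ⟨i, hi, Or.inl h.symm⟩
  have neq : ∀ i ≤ n, g i ≠ q := fun i hi h => nq' i hi (h ▸ hqq)
  have hex : ∃ i, i ≤ n ∧ G.Adj (g i) q := by
    obtain ⟨i, hi, h | h⟩ := hq
    · exact (neq i hi h.symm).elim
    · exact ⟨i, hi, h.symm⟩
  have q0 : ¬ G.Adj (g 0) q := fun h => neq 1 n0 (g1.trans ((hb 0 _).1 (g0 ▸ h)).symm)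
  have qn : ¬ G.Adj (g n) q := fun h =>
    neq (n - 1) (by omega) (gn1.trans ((hb 1 _).1 (gn ▸ h)).symm)
  classical
  obtain ⟨hi, hiq⟩ := Nat.find_spec hex
  have hmin : ∀ j < Nat.find hex, ¬ G.Adj (g j) q := fun j hj h =>
    Nat.find_min hex hj ⟨by omega, h⟩
  generalize Nat.find hex = i at hi hiq hmin
  have i0 : 0 < i := Nat.pos_of_ne_zero fun h => q0 (h ▸ hiq)
  have i1 : i < n := lt_of_le_of_ne hi fun h => qn (h ▸ hiq)
  -- With `g i` the first path neighbor of `q`: a neighbor beyond `g (i + 1)` gives a claw at `q`,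
  -- exactly the two consecutive neighbors give a net, and a single one gives a claw at `g i`.
  by_cases hj : ∃ j, i + 1 < j ∧ j ≤ n ∧ G.Adj (g j) q
  · obtain ⟨j, hij, hjn, hjq⟩ := hj
    obtain ⟨f, -⟩ := exists_claw_embedding hiq.symm hjq.symm hqq
      (ginj i j (by omega) hjn) (neq' i hi) (neq' j hjn) (gnadj i j hij hjn) (nq' i hi) (nq' j hjn)
    exact Or.inl ⟨f⟩
  by_cases hs : G.Adj (g (i + 1)) q
  · have i2 : i + 1 < n := lt_of_le_of_ne (by omega) fun h => qn (h ▸ hs)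
    have hs2 : ¬ G.Adj (g (i + 2)) q := fun h => hj ⟨i + 2, by omega, by omega, h⟩
    have hs0 : ¬ G.Adj (g (i - 1)) q := hmin _ (by omega)
    have e0 := gadj (i - 1) (by omega)
    rw [Nat.sub_add_cancel i0] at e0
    have e1 := gadj i i1
    have e2 : G.Adj (g (i + 1)) (g (i + 2)) := gadj (i + 1) i2
    have f1 := gnadj (i - 1) (i + 1) (by omega) (by omega)
    have f2 := gnadj (i - 1) (i + 2) (by omega) (by omega)
    have f3 := gnadj i (i + 2) (by omega) (by omega)
    have r0 := nq' (i - 1) (by omega)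
    have r1 := nq' i (by omega)
    have r2 := nq' (i + 1) (by omega)
    have r3 := nq' (i + 2) (by omega)
    have s0 := ginj (i - 1) i (by omega) (by omega)
    have s1 := ginj (i - 1) (i + 1) (by omega) (by omega)
    have s2 := ginj i (i + 2) (by omega) (by omega)
    have s3 := ginj (i + 1) (i + 2) (by omega) (by omega)
    have t0 := neq (i - 1) (by omega)
    have t1 := neq (i + 2) (by omega)
    have u1 := neq' i (by omega)
    have u2 := neq' (i + 1) (by omega)
    have u3 := hqq.ne
    refine Or.inr (exists_net_embedding (a := ![g i, g (i + 1), q])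
      (b := ![g (i - 1), g (i + 2), q']) ?_ ?_ ?_ ?_)
    · intro k l hkl
      fin_cases k <;> fin_cases l <;> first
        | exact (hkl rfl).elim
        | assumption
        | exact SimpleGraph.Adj.symm (by assumption)
    · intro k l
      fin_cases k <;> fin_cases l <;> first
        | exact iff_of_true (by assumption) rfl
        | exact iff_of_true (SimpleGraph.Adj.symm (by assumption)) rfl
        | exact iff_of_false (by assumption) (by decide)
        | exact iff_of_false (fun h => absurd h.symm (by assumption)) (by decide)
    · intro k l
      fin_cases k <;> fin_cases l <;> first
        | exact G.irrefl
        | assumption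
        | exact fun h => absurd h.symm (by assumption)
    · intro k l
      fin_cases k <;> fin_cases l <;> first
        | assumption
        | exact Ne.symm (by assumption)
  · exact Or.inl (claw_of i q i0 i1 hiq (hmin _ (by omega)) hs (neq _ (by omega))
      (neq _ (by omega)))

/-! ### Lines of the closure -/

/-- A clique that contains every common neighbor of any two of its vertices. -/
structure IsLine {V : Type*} (H : SimpleGraph V) (K : Set V) : Prop where
  isClique : H.IsClique K
  mem_of_adj : ∀ ⦃u v w⦄, u ∈ K → v ∈ K → u ≠ v → H.Adj w u → H.Adj w v → w ∈ K

/-- Neighbors of distinct members of a line outside the line are distinct. -/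
theorem IsLine.eq_of_adj {V : Type*} {H : SimpleGraph V} {K : Set V} (hK : IsLine H K)
    {k k' w : V} (hk : k ∈ K) (hk' : k' ∈ K) (hw : w ∉ K) (h : H.Adj w k) (h' : H.Adj w k') : k = k' := by
  by_contra hne
  exact hw (hK.mem_of_adj hk hk' hne h h')

/-- Adjacency in `G` between members of `K`. -/
def AdjIn {V : Type*} (G : SimpleGraph V) (K : Set V) (u v : V) : Prop :=
  u ∈ K ∧ v ∈ K ∧ G.Adj u v

/-- The properties of a claw-`o`-heavy graph `G` and its `c`-closure `H` that are used below. -/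
structure ClosurePair {V : Type*} [Fintype V] (G H : SimpleGraph V) : Prop where
  le : G ≤ H
  claw_heavy : IsOHeavy claw G
  claw_heavy' : IsOHeavy claw H
  not_heavy : ∀ a b, ¬ IsOHeavyPair H a b
  diamondFree : DiamondFree H
  connected_line : ∀ K, IsLine H K → ∀ u ∈ K, ∀ v ∈ K, Relation.ReflTransGen (AdjIn G K) u v

/-- Undoing the completions one by one, an edge added at `x` becomes a path through `x`, and `x` is
in `K` as a common neighbor of two members. -/
theorem reflTransGen_adjIn_of_cStep {V : Type*} [Fintype V] {G H : SimpleGraph V} {K : Set V}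
    (hK : IsLine H K) (h : Relation.ReflTransGen CStep G H) (u v : V) (huv : AdjIn H K u v) :
    Relation.ReflTransGen (AdjIn G K) u v := by
  induction h using Relation.ReflTransGen.head_induction_on generalizing u v with
  | refl => exact .single huv
  | @head F F' hstep h ih =>
    have hle := le_of_reflTransGen_cStep h
    obtain ⟨x, -, rfl⟩ := hstep
    have lift : ∀ s t, Relation.ReflTransGen (AdjIn (localCompletion F x) K) s t →
        Relation.ReflTransGen (AdjIn F K) s t := by
      intro s t hst
      induction hst with
      | refl => exact .refl
      | @tail t t' _ htt ih' =>
        obtain ⟨ht, ht', e | ⟨hne, xt, xt'⟩⟩ := htt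
        · exact ih'.tail ⟨ht, ht', e⟩
        · have hx : x ∈ K := hK.mem_of_adj ht ht' hne (hle (Or.inl xt)) (hle (Or.inl xt'))
          exact (ih'.tail ⟨ht, hx, xt.symm⟩).tail ⟨hx, ht', xt'⟩
    exact lift u v (ih u v huv)

theorem IsCClosure.closurePair {V : Type*} [Fintype V] {G H : SimpleGraph V}
    (hG : IsOHeavy claw G) (h : IsCClosure G H) : ClosurePair G H where
  le := le_of_reflTransGen_cStep h.1
  claw_heavy := hG
  claw_heavy' := hG.of_reflTransGen_cStep h.1
  not_heavy := not_isOHeavyPair_of_no_eligible (hG.of_reflTransGen_cStep h.1) h.2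
  diamondFree := diamondFree_of_no_eligible (hG.of_reflTransGen_cStep h.1) h.2
  connected_line K hK u hu v hv := by
    by_cases e : u = v
    · rw [e]
    · exact reflTransGen_adjIn_of_cStep hK h.1 u v ⟨hu, hv, hK.isClique hu hv e⟩

namespace ClosurePair

variable {V : Type*} [Fintype V] {G H : SimpleGraph V} {K : Set V}

theorem adj_of_isOHeavyPair (h : ClosurePair G H) {u v : V} (huv : IsOHeavyPair G u v) :
    H.Adj u v := by
  by_contra hn
  exact h.not_heavy u v (huv.mono h.le hn)

theorem isLine_of_adj (h : ClosurePair G H) {u v : V} (huv : H.Adj u v) :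
    IsLine H {w | w = u ∨ w = v ∨ (H.Adj w u ∧ H.Adj w v)} := by
  constructor
  · rintro p (rfl | rfl | ⟨pu, pv⟩) q (rfl | rfl | ⟨qu, qv⟩) hne
    · exact (hne rfl).elim
    · exact huv
    · exact qu.symm
    · exact huv.symm
    · exact (hne rfl).elim
    · exact qv.symm
    · exact pu
    · exact pv
    · exact h.diamondFree pu.symm huv qu.symm pv qv.symm hne
  · rintro p q w (rfl | rfl | ⟨pu, pv⟩) (rfl | rfl | ⟨qu, qv⟩) hne hwp hwq
    · exact (hne rfl).elim
    · exact Or.inr (Or.inr ⟨hwp, hwq⟩)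
    · by_cases e : w = v
      · exact Or.inr (Or.inl e)
      · exact Or.inr (Or.inr ⟨hwp, h.diamondFree hwp.symm qu.symm huv hwq qv e⟩)
    · exact Or.inr (Or.inr ⟨hwq, hwp⟩)
    · exact (hne rfl).elim
    · by_cases e : w = u
      · exact Or.inl e
      · exact Or.inr (Or.inr ⟨h.diamondFree hwp.symm qv.symm huv.symm hwq qu e, hwp⟩)
    · by_cases e : w = v
      · exact Or.inr (Or.inl e)
      · exact Or.inr (Or.inr ⟨hwq, h.diamondFree hwq.symm pu.symm huv hwp pv e⟩)
    · by_cases e : w = u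
      · exact Or.inl e
      · exact Or.inr (Or.inr ⟨h.diamondFree hwq.symm pv.symm huv.symm hwp pu e, hwq⟩)
    · have pq : H.Adj p q := h.diamondFree pu.symm huv qu.symm pv qv.symm hne
      by_cases eu : w = u
      · exact Or.inl eu
      by_cases ev : w = v
      · exact Or.inr (Or.inl ev)
      exact Or.inr (Or.inr ⟨h.diamondFree hwp.symm pq pu hwq qu eu,
        h.diamondFree hwp.symm pq pv hwq qv ev⟩)

/-- The second line through a vertex of a line. -/
theorem isLine_other (h : ClosurePair G H) (hK : IsLine H K) {k r : V} (hk : k ∈ K) (hr : r ∈ K)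
    (hne : r ≠ k) : IsLine H {v | v = k ∨ (H.Adj k v ∧ v ∉ K)} := by
  -- Otherwise `u`, `v`, `r` would be the ends of a claw of `H` at `k`.
  have hcl : ∀ u v, H.Adj k u → u ∉ K → H.Adj k v → v ∉ K → u ≠ v → H.Adj u v := by
    intro u v ku hu kv hv huv
    by_contra hn
    have kr : H.Adj k r := hK.isClique hk hr hne.symm
    have e : ∀ w, H.Adj k w → w ∉ K → ¬ H.Adj w r := fun w kw hw hwr =>
      hne (hK.eq_of_adj hr hk hw hwr kw.symm)
    have ne : ∀ w, w ∉ K → w ≠ r := fun w hw e => hw (e ▸ hr)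
    rcases h.claw_heavy'.exists_pair_of_claw ku kv kr huv (ne u hu) (ne v hv) hn (e u ku hu)
      (e v kv hv) with h' | h' | h' <;> exact h.not_heavy _ _ h'
  have hout : ∀ w v, H.Adj w k → H.Adj w v → H.Adj k v → v ∉ K → w ∉ K := fun w v wk wv kv hv hw =>
    wk.ne (hK.eq_of_adj hw hk hv wv.symm kv.symm)
  constructor
  · rintro u (rfl | ⟨ku, hu⟩) v (rfl | ⟨kv, hv⟩) huv
    · exact (huv rfl).elim
    · exact kv
    · exact ku.symm
    · exact hcl u v ku hu kv hv huv
  · rintro u v w (rfl | ⟨ku, hu⟩) (rfl | ⟨kv, hv⟩) huv wu wv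
    · exact (huv rfl).elim
    · exact Or.inr ⟨wu.symm, hout w v wu wv kv hv⟩
    · exact Or.inr ⟨wv.symm, hout w u wv wu ku hu⟩
    · by_cases e : w = k
      · exact Or.inl e
      have wk : H.Adj w k := h.diamondFree wu.symm (hcl u v ku hu kv hv huv) ku.symm wv kv.symm e
      exact Or.inr ⟨wk.symm, hout w u wk wu ku hu⟩

/-! ### Heavy pairs and bypasses inside a line -/

/-- An `o`-heavy pair of `G` inside a line of `H` has a common neighbor all of whose
`H`-neighbors lie in the line. -/
theorem exists_common_of_isOHeavyPair (h : ClosurePair G H) (hK : IsLine H K) {x y : V}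
    (hx : x ∈ K) (hy : y ∈ K) (hxy : IsOHeavyPair G x y) :
    ∃ c ∈ K, G.Adj x c ∧ G.Adj y c ∧ ∀ v, H.Adj c v → v ∈ K := by
  classical
  by_contra! hno
  let E : V → Finset V := fun k => Finset.univ.filter fun v => H.Adj k v ∧ v ∉ K
  let A : V → Finset V := fun k => Finset.univ.filter fun v => G.Adj k v ∧ v ∈ K
  let KF : Finset V := Finset.univ.filter (· ∈ K)
  have hdeg : ∀ k, G.degree k ≤ (A k).card + (E k).card := by
    intro k
    rw [← SimpleGraph.card_neighborFinset_eq_degree]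
    refine (Finset.card_le_card fun v hv => ?_).trans (Finset.card_union_le _ _)
    rw [SimpleGraph.mem_neighborFinset] at hv
    by_cases e : v ∈ K
    · simp [A, E, e, hv]
    · simp [A, E, e, h.le hv]
  have hCE : ∀ c ∈ A x ∩ A y, 1 ≤ (E c).card := by
    intro c hc
    simp only [A, Finset.mem_inter, Finset.mem_filter, Finset.mem_univ, true_and] at hc
    obtain ⟨v, hv, hvK⟩ := hno c hc.1.2 hc.1.1 hc.2.1
    exact Finset.card_pos.2 ⟨v, by simp [E, hv, hvK]⟩
  have hA : (A x ∪ A y).card + 2 ≤ KF.card := by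
    have hs : insert x (insert y (A x ∪ A y)) ⊆ KF := by
      intro v hv
      simp only [A, Finset.mem_insert, Finset.mem_union, Finset.mem_filter, Finset.mem_univ,
        true_and, KF] at hv ⊢
      rcases hv with rfl | rfl | hv | hv
      exacts [hx, hy, hv.2, hv.2]
    have := Finset.card_le_card hs
    rw [Finset.card_insert_of_notMem (by simp [A, hxy.1, hxy.symm.2.1]),
      Finset.card_insert_of_notMem (by simp [A, hxy.2.1])] at this
    exact this
  -- The sets `E k` are disjoint and outside `K`. If every common neighbor contributes at least one
  -- vertex, the total is at least $d_G(x)+d_G(y)+2$.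
  let T : Finset V := insert x (insert y (A x ∩ A y))
  have hT : ∀ k ∈ T, k ∈ K := by
    intro k hk
    simp only [T, A, Finset.mem_insert, Finset.mem_inter, Finset.mem_filter, Finset.mem_univ,
      true_and] at hk
    rcases hk with rfl | rfl | hk
    exacts [hx, hy, hk.1.2]
  have hdisj : ∀ k ∈ T, ∀ k' ∈ T, k ≠ k' → Disjoint (E k) (E k') := by
    intro k hk k' hk' hne
    rw [Finset.disjoint_left]
    intro v hv hv'
    simp only [E, Finset.mem_filter, Finset.mem_univ, true_and] at hv hv'
    exact hne (hK.eq_of_adj (hT k hk) (hT k' hk') hv.2 hv.1.symm hv'.1.symm)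
  have hdisj' : Disjoint KF (T.biUnion E) := by
    rw [Finset.disjoint_left]
    intro v hv hv'
    simp only [E, KF, Finset.mem_biUnion, Finset.mem_filter, Finset.mem_univ, true_and] at hv hv'
    obtain ⟨_, _, _, h'⟩ := hv'
    exact h' hv
  have hcard := Finset.card_le_univ (KF ∪ T.biUnion E)
  rw [Finset.card_union_of_disjoint hdisj', Finset.card_biUnion hdisj,
    Finset.sum_insert (by simp [A, hxy.1]), Finset.sum_insert (by simp [A])] at hcard
  have hC : (A x ∩ A y).card ≤ ∑ c ∈ A x ∩ A y, (E c).card := by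
    simpa using Finset.card_nsmul_le_sum _ _ 1 hCE
  have hui := Finset.card_union_add_card_inter (A x) (A y)
  have hheavy : Fintype.card V ≤ G.degree x + G.degree y := by
    convert hxy.2.2
  have := hdeg x
  have := hdeg y
  omega

/-- Inside a line, the `G`-neighbors of a vertex that has neighbors outside the line are pairwise
adjacent or `o`-heavy. -/
theorem adj_or_isOHeavyPair (h : ClosurePair G H) (hK : IsLine H K) {k p q w : V} (hk : k ∈ K)
    (hp : p ∈ K) (hq : q ∈ K) (hpq : p ≠ q) (kp : G.Adj k p) (kq : G.Adj k q)
    (kw : H.Adj k w) (hw : w ∉ K) : G.Adj p q ∨ IsOHeavyPair G p q := by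
  have hK' := h.isLine_other hK hk hp kp.ne'
  -- Connectedness of the second line at `k` in `G` supplies the third end of a claw.
  have hz : ∃ z, G.Adj k z ∧ z ∉ K := by
    rcases (h.connected_line _ hK' k (Or.inl rfl) w (Or.inr ⟨kw, hw⟩)).cases_head with e | ⟨z, hz, -⟩
    · exact (kw.ne e).elim
    · exact ⟨z, hz.2.2, (hz.2.1.resolve_left hz.2.2.ne').2⟩
  obtain ⟨z, kz, hz⟩ := hz
  have nz : ∀ u ∈ K, G.Adj k u → u ≠ z ∧ ¬ H.Adj u z := fun u hu ku =>
    ⟨fun e => hz (e ▸ hu), fun e => ku.ne (hK.eq_of_adj hk hu hz (h.le kz).symm e.symm)⟩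
  by_contra! hn
  have np := nz p hp kp
  have nq := nz q hq kq
  rcases h.claw_heavy.exists_pair_of_claw kp kq kz hpq np.1 nq.1 hn.1 (fun e => np.2 (h.le e))
    (fun e => nq.2 (h.le e)) with h' | h' | h'
  exacts [hn.2 h', np.2 (h.adj_of_isOHeavyPair h'), nq.2 (h.adj_of_isOHeavyPair h')]

/-- A vertex `a` of a line is `G`-adjacent to a vertex of the line without neighbors outside the
line, or to any prescribed vertex of the line. -/
theorem exists_adj_line (h : ClosurePair G H) (hK : IsLine H K) {a b : V} (ha : a ∈ K) (hb : b ∈ K)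
    (hne : b ≠ a) : ∃ b' ∈ K, G.Adj a b' ∧ (b' = b ∨ ∀ v, H.Adj b' v → v ∈ K) := by
  by_contra! hno
  have hno' : ∀ c ∈ K, G.Adj a c → ∃ w, H.Adj c w ∧ w ∉ K := fun c hc hac => (hno c hc hac).2
  -- Without such a `b'`, adjacency to `a` would spread through all of `K` and reach `b`.
  have key : ∀ v, Relation.ReflTransGen (AdjIn G K) a v → v = a ∨ G.Adj a v := by
    intro v hv
    induction hv with
    | refl => exact Or.inl rfl
    | @tail v w _ hvw ih =>
      rcases ih with rfl | hav
      · exact Or.inr hvw.2.2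
      by_cases e : w = a
      · exact Or.inl e
      obtain ⟨t, vt, ht⟩ := hno' v hvw.1 hav
      refine Or.inr ((h.adj_or_isOHeavyPair hK hvw.1 ha hvw.2.1 (Ne.symm e) hav.symm hvw.2.2 vt
        ht).resolve_right fun hh => ?_)
      obtain ⟨c, hc, hac, -, hcK⟩ := h.exists_common_of_isOHeavyPair hK ha hvw.2.1 hh
      obtain ⟨t, ct, ht⟩ := hno' c hc hac
      exact ht (hcK t ct)
  exact (hno b hb ((key b (h.connected_line K hK a ha b hb)).resolve_left hne)).1 rfl

/-- Vertices of a line with neighbors outside the line can be bypassed, if they are not needed. -/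
theorem reflTransGen_adjIn_subset (h : ClosurePair G H) (hK : IsLine H K) {L : Set V} (hLK : L ⊆ K)
    (hL : ∀ k ∈ K, (∀ v, H.Adj k v → v ∈ K) → k ∈ L) {u v : V} (hu : u ∈ L) (hv : v ∈ L) :
    Relation.ReflTransGen (AdjIn G L) u v := by
  -- Walking through `K`, one keeps a reached vertex of `L` that equals the current vertex or is
  -- adjacent to it.
  have key : ∀ v, Relation.ReflTransGen (AdjIn G K) u v →
      (v ∈ L ∧ Relation.ReflTransGen (AdjIn G L) u v) ∨
      (v ∉ L ∧ ∃ w ∈ L, Relation.ReflTransGen (AdjIn G L) u w ∧ G.Adj w v) := by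
    intro v hv
    induction hv with
    | refl => exact Or.inl ⟨hu, .refl⟩
    | @tail v v' _ hvv ih =>
      have ext : ∀ w ∈ L, Relation.ReflTransGen (AdjIn G L) u w → G.Adj w v' →
          (v' ∈ L ∧ Relation.ReflTransGen (AdjIn G L) u v') ∨
          (v' ∉ L ∧ ∃ w ∈ L, Relation.ReflTransGen (AdjIn G L) u w ∧ G.Adj w v') := by
        intro w hw huw hwv
        by_cases e : v' ∈ L
        · exact Or.inl ⟨e, huw.tail ⟨hw, e, hwv⟩⟩
        · exact Or.inr ⟨e, w, hw, huw, hwv⟩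
      rcases ih with ⟨hvL, huv⟩ | ⟨hvL, w, hw, huw, hwv⟩
      · exact ext v hvL huv hvv.2.2
      have hout : ∃ t, H.Adj v t ∧ t ∉ K := by
        by_contra! hn
        exact hvL (hL v hvv.1 hn)
      obtain ⟨t, vt, ht⟩ := hout
      by_cases e : w = v'
      · exact Or.inl ⟨e ▸ hw, e ▸ huw⟩
      rcases h.adj_or_isOHeavyPair hK hvv.1 (hLK hw) hvv.2.1 e hwv.symm hvv.2.2 vt ht with h' | h'
      · exact ext w hw huw h'
      · obtain ⟨c, hc, hwc, hvc, hcK⟩ := h.exists_common_of_isOHeavyPair hK (hLK hw) hvv.2.1 h'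
        have hcL := hL c hc hcK
        exact ext c hcL (huw.tail ⟨hw, hcL, hwc⟩) hvc.symm
  rcases key v (h.connected_line K hK u (hLK hu) v (hLK hv)) with h' | h'
  · exact h'.2
  · exact (h'.1 hv).elim

end ClosurePair

/-! ### Nets of the closure -/

theorem ClosurePair.isNetPHeavy {V : Type*} [Fintype V] {G H : SimpleGraph V}
    (h : ClosurePair G H) (hnet : IsOHeavy net G) : IsNetPHeavy H := by
  classical
  intro f
  by_contra! hlight
  obtain ⟨a, ha⟩ : ∃ a : Fin 3 → V, ∀ i, a i = f (.inl i) := ⟨_, fun _ => rfl⟩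
  obtain ⟨b, hb⟩ : ∃ b : Fin 3 → V, ∀ i, b i = f (.inr i) := ⟨_, fun _ => rfl⟩
  simp only [← ha] at hlight
  have hai : Function.Injective a := fun i j e => by
    simpa using f.injective ((ha i).symm.trans (e.trans (ha j)))
  have haa : ∀ i j, i ≠ j → H.Adj (a i) (a j) := fun i j hij => by
    rw [ha, ha]
    exact f.map_adj_iff.2 hij
  have hab : ∀ i j, H.Adj (a i) (b j) ↔ i = j := fun i j => by
    rw [ha, hb]
    exact f.map_adj_iff
  have hbb : ∀ i j, ¬ H.Adj (b i) (b j) := fun i j e => by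
    rw [hb, hb] at e
    exact f.map_adj_iff.1 e
  have hne : ∀ i j, b i ≠ a j := fun i j e => by
    simpa using f.injective ((hb i).symm.trans (e.trans (ha j)))
  have other : ∀ i : Fin 3, ∃ j, j ≠ i := by decide
  obtain ⟨K, hK, haK⟩ : ∃ K, IsLine H K ∧ ∀ i, a i ∈ K := by
    refine ⟨_, h.isLine_of_adj (haa 0 1 (by decide)), fun i => ?_⟩
    fin_cases i
    exacts [Or.inl rfl, Or.inr (Or.inl rfl),
      Or.inr (Or.inr ⟨haa 2 0 (by decide), haa 2 1 (by decide)⟩)]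
  have hbK : ∀ i, b i ∉ K := fun i hi => by
    obtain ⟨j, hj⟩ := other i
    exact hj ((hab j i).1 (hK.isClique (haK j) hi (hne i j).symm))
  -- The edge from `a i` to `b i` need not be in `G`. Either alternative for `c` keeps the three
  -- chosen vertices pairwise nonadjacent in `H`.
  have hc : ∀ i, ∃ c, G.Adj (a i) c ∧ c ∉ K ∧
      (c = b i ∨ ∀ v, H.Adj c v → v = a i ∨ (H.Adj (a i) v ∧ v ∉ K)) := by
    intro i
    obtain ⟨j, hj⟩ := other i
    obtain ⟨c, hcK, hac, hc⟩ := h.exists_adj_line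
      (h.isLine_other hK (haK i) (haK j) (hai.ne hj)) (Or.inl rfl)
      (Or.inr ⟨(hab i i).2 rfl, hbK i⟩) (hne i i)
    exact ⟨c, hac, (hcK.resolve_left hac.ne').2, hc⟩
  choose c hac hcK hc using hc
  have hkc : ∀ k ∈ K, ∀ i, H.Adj k (c i) → k = a i := fun k hk i e =>
    hK.eq_of_adj hk (haK i) (hcK i) e.symm (h.le (hac i)).symm
  have hcc : ∀ i j, i ≠ j → ¬ H.Adj (c i) (c j) := by
    have aux : ∀ i j, i ≠ j → (∀ v, H.Adj (c i) v → v = a i ∨ (H.Adj (a i) v ∧ v ∉ K)) →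
        ¬ H.Adj (c i) (c j) := by
      intro i j hij hi e
      rcases hi _ e with e | ⟨e, -⟩
      · exact hcK j (e ▸ haK i)
      · exact hij (hai (hkc _ (haK i) j e))
    intro i j hij e
    rcases hc i with hi | hi
    · rcases hc j with hj | hj
      · exact hbb i j (hi ▸ hj ▸ e)
      · exact aux j i hij.symm hj e.symm
    · exact aux i j hij hi e
  let L : Set V := {k | k ∈ K ∧ ((∀ v, H.Adj k v → v ∈ K) ∨ ∃ i, k = a i)}
  have haL : ∀ i, a i ∈ L := fun i => ⟨haK i, Or.inr ⟨i, rfl⟩⟩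
  have hdeg : ∀ k ∈ L, (∀ i, H.degree k ≤ H.degree (a i)) ∨ ∃ i, k = a i := by
    rintro k ⟨hk, hs | hs⟩
    · refine Or.inl fun i => ?_
      have hsub : insert k (H.neighborFinset k) ⊆ insert (a i) (H.neighborFinset (a i)) := by
        have hKs : ∀ v ∈ K, v ∈ insert (a i) (H.neighborFinset (a i)) := by
          intro v hv
          by_cases e : v = a i
          · simp [e]
          · simp [hK.isClique (haK i) hv (Ne.symm e)]
        intro v hv
        rw [Finset.mem_insert, SimpleGraph.mem_neighborFinset] at hv
        rcases hv with rfl | hv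
        · exact hKs _ hk
        · exact hKs _ (hs v hv)
      have := Finset.card_le_card hsub
      rw [Finset.card_insert_of_notMem (by simp), Finset.card_insert_of_notMem (by simp),
        SimpleGraph.card_neighborFinset_eq_degree, SimpleGraph.card_neighborFinset_eq_degree]
        at this
      omega
    · exact Or.inr hs
  have hlightL : ∀ p ∈ L, ∀ q ∈ L, ¬ IsOHeavyPair G p q := by
    intro p hp q hq hpq
    -- The degrees of an `o`-heavy pair are charged to two distinct triangle vertices; a vertex
    -- confined to `K` may be charged to any of them.
    have hsum : ∀ i j, i ≠ j → H.degree p ≤ H.degree (a i) → H.degree q ≤ H.degree (a j) →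
        False := by
      intro i j hij h1 h2
      refine hlight i j ⟨haa i j hij, ?_⟩
      have h3 := hpq.2.2
      have h4 := degree_le_degree h.le p
      have h5 := degree_le_degree h.le q
      convert h3.trans ((add_le_add h4 h5).trans (add_le_add (b := H.degree (a i))
        (d := H.degree (a j)) ?_ ?_))
      · convert h1
      · convert h2
    rcases hdeg p hp with h1 | ⟨i, rfl⟩
    · rcases hdeg q hq with h2 | ⟨j, rfl⟩
      · exact hsum 0 1 (by decide) (h1 0) (h2 1)
      · obtain ⟨i, hi⟩ := other j
        exact hsum i j hi (h1 i) le_rfl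
    · rcases hdeg q hq with h2 | ⟨j, rfl⟩
      · obtain ⟨j, hj⟩ := other i
        exact hsum i j hj.symm le_rfl (h2 j)
      · exact hsum i j (fun e => hpq.1 (congrArg a e)) le_rfl le_rfl
  let S : Set V := L ∪ Set.range c
  have hlightS : ∀ p ∈ S, ∀ q ∈ S, ¬ IsOHeavyPair G p q := by
    rintro p (hp | ⟨i, rfl⟩) q (hq | ⟨j, rfl⟩) hpq
    · exact hlightL p hp q hq hpq
    · have e := hkc p hp.1 j (h.adj_of_isOHeavyPair hpq)
      exact hpq.2.1 (e ▸ hac j)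
    · have e := hkc q hq.1 i (h.adj_of_isOHeavyPair hpq).symm
      exact hpq.2.1 (e ▸ (hac i).symm)
    · by_cases e : i = j
      · exact hpq.1 (congrArg c e)
      · exact hcc i j e (h.adj_of_isOHeavyPair hpq)
  have haS : ∀ i, a i ∈ S := fun i => Or.inl (haL i)
  have hcS : ∀ i, c i ∈ S := fun i => Or.inr ⟨i, rfl⟩
  have hreach : ∀ v (hv : v ∈ S), (G.induce S).Reachable ⟨a 0, haS 0⟩ ⟨v, hv⟩ := by
    have hL : ∀ v, Relation.ReflTransGen (AdjIn G L) (a 0) v → ∀ hv : v ∈ S,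
        (G.induce S).Reachable ⟨a 0, haS 0⟩ ⟨v, hv⟩ := by
      intro v h0v
      induction h0v with
      | refl => exact fun _ => .refl _
      | @tail v w _ hvw ih =>
        intro hw
        refine (ih (Or.inl hvw.1)).trans (SimpleGraph.Adj.reachable ?_)
        exact hvw.2.2
    have hL' : ∀ v ∈ L, Relation.ReflTransGen (AdjIn G L) (a 0) v := fun v hv =>
      h.reflTransGen_adjIn_subset hK (L := L) (fun k hk => hk.1)
        (fun k hk hs => ⟨hk, Or.inl hs⟩)
        (haL 0) hv
    rintro v (hv | ⟨i, rfl⟩)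
    · exact hL v (hL' v hv) _
    · refine (hL _ (hL' _ (haL i)) (haS i)).trans (SimpleGraph.Adj.reachable ?_)
      exact hac i
  have hconn : (G.induce S).Connected :=
    { preconnected := fun u v => (hreach u u.2).symm.trans (hreach v v.2)
      nonempty := ⟨⟨a 0, haS 0⟩⟩ }
  let a' : Fin 3 → S := fun i => ⟨a i, haS i⟩
  let c' : Fin 3 → S := fun i => ⟨c i, hcS i⟩
  have hleaf : ∀ i (w : S), (G.induce S).Adj (c' i) w ↔ w = a' i := by
    rintro i ⟨w, hw⟩
    constructor
    · intro e
      replace e : G.Adj (c i) w := e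
      rcases hw with hw | ⟨j, rfl⟩
      · exact Subtype.ext (hkc w hw.1 i (h.le e).symm)
      · exact (hcc i j (fun hij => e.ne (congrArg c hij)) (h.le e)).elim
    · intro e
      rw [e]
      exact (hac i).symm
  have hca' : ∀ i j, c' i ≠ a' j := fun i j e => by
    have e' : c i = a j := congrArg Subtype.val e
    exact hcK i (e' ▸ haK j)
  rcases exists_claw_or_net hconn hleaf (fun i j e => hai (congrArg Subtype.val e)) hca'
    with hg | hg
  · obtain ⟨g⟩ := hg
    obtain ⟨i, j, hij⟩ := h.claw_heavy ((SimpleGraph.Embedding.induce S).comp g)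
    exact hlightS _ (g i).2 _ (g j).2 hij
  · obtain ⟨g⟩ := hg
    obtain ⟨i, j, hij⟩ := hnet ((SimpleGraph.Embedding.induce S).comp g)
    exact hlightS _ (g i).2 _ (g j).2 hij

end HeavyClosure

theorem mainTheorem7 {V : Type*} [Fintype V] (G : SimpleGraph V)
    (hclaw : HeavyClosure.IsOHeavy HeavyClosure.claw G)
    (hnet : HeavyClosure.IsOHeavy HeavyClosure.net G)
    (H : SimpleGraph V) (hH : HeavyClosure.IsCClosure G H) :
    HeavyClosure.IsFree HeavyClosure.claw H ∧ HeavyClosure.IsNetPHeavy H :=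
  ⟨HeavyClosure.isFree_claw_of_no_eligible (hclaw.of_reflTransGen_cStep hH.1) hH.2,
    (hH.closurePair hclaw).isNetPHeavy hnet⟩
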